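/- Let $n\ge 0$ be an integer and let $C\ell(n)$ be the real Clifford algebra of $\mathbb{R}^n$ with its standard inner product, i.e. the associative unital $\mathbb{R}$-algebra generated by $\mathbb{R}^n$ subject to $v\cdot v=-|v|^2\,1$ for $v\in\mathbb{R}^n$. Let $c:C\ell(n)\to C\ell(n)$ be the unique $\mathbb{R}$-linear anti-automorphism with $c(v)=-v$ for $v\in\mathbb{R}^n$; equivalently $c=\alpha\circ\tau$, where $\alpha$ is the algebra automorphism with $\alpha(v)=-v$ and $\tau$ the anti-automorphism with $\tau(v)=v$ for $v\in\mathbb{R}^n$. For $K=\mathbb{R},\mathbb{C}$ or the quaternions $\mathbb{H}$ let $M(p,K)$ be the algebra of $p\times p$ matrices over $K$, let $X^*$ be the conjugate transpose of $X\in M(p,K)$, $(X^*)_{ij}=\overline{X_{ji}}$, and put $(X,Y)^*=(X^*,Y^*)$ on $M(p,K)\oplus M(p,K)$. **Proposition 9.1.** Let $k\ge 0$ and $0\le\alpha\le 7$ be integers, and let $A$ be the algebra given by the following list for $n=8k+\alpha$: 1. $n=8k$: $A=M(2^{4k},\mathbb{R})$; 2. $n=8k+1$: $A=M(2^{4k},\mathbb{C})$;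 3. $n=8k+2$: $A=M(2^{4k},\mathbb{H})$; 4. $n=8k+3$: $A=M(2^{4k},\mathbb{H})\oplus M(2^{4k},\mathbb{H})$; 5. $n=8k+4$: $A=M(2^{4k+1},\mathbb{H})$; 6. $n=8k+5$: $A=M(2^{4k+2},\mathbb{C})$; 7. $n=8k+6$: $A=M(2^{4k+3},\mathbb{R})$; 8. $n=8k+7$: $A=M(2^{4k+3},\mathbb{R})\oplus M(2^{4k+3},\mathbb{R})$. In each of these cases there exists an isomorphism of $\mathbb{R}$-algebras $\rho:C\ell(n)\to A$ such that $\rho(c(x))=\rho(x)^*$ for all $x\in C\ell(n)$. -/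

import Mathlib

open scoped Matrix Quaternion

/-- The standard positive definite form `x ↦ x₁² + ⋯ + xₙ²` on `ℝⁿ`. -/
noncomputable def euclideanForm (n : ℕ) : QuadraticForm ℝ (Fin n → ℝ) :=
  QuadraticMap.weightedSumSquares ℝ (fun _ : Fin n => (1 : ℝ))

/-- The Clifford algebra `Cℓ(n)` of Euclidean space, with the sign convention `v · v = -‖v‖² 1`.
Mathlib's `CliffordAlgebra Q` has the convention `v · v = Q(v) 1`, hence the minus sign. -/
abbrev Cl (n : ℕ) : Type := CliffordAlgebra (-euclideanForm n)

/-- The canonical anti-automorphism `c = α ∘ τ` of `Cℓ(n)`, where `α` is the algebra automorphism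
that is `-1` on `ℝⁿ` and `τ` is the anti-automorphism that is the identity on `ℝⁿ`. -/
noncomputable def clConj {n : ℕ} (x : Cl n) : Cl n :=
  CliffordAlgebra.involute (CliffordAlgebra.reverse x)

/-- `M(p, K)`, the algebra of `p × p` matrices over `K`. -/
abbrev Mat (p : ℕ) (K : Type) : Type := Matrix (Fin p) (Fin p) K

/-! A star algebra generated by n anticommuting skew-adjoint square roots of -1 is a quotient of
Cℓ(n) by the universal property, and the quotient map intertwines c with the star because both are
anti-automorphisms that negate the generators. If its dimension is 2^n, the map is an isomorphism
(`CliffordGenerated.exists_algEquiv`). It remains to exhibit generators.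

Periodicity comes from Cℓ(n+4) ≅ M(2, Cℓ(n) ⊗ ℍ), in the form of
`CliffordGenerated.quaternionExtension`. Together with ℝ ⊗ ℍ = ℍ, ℂ ⊗ ℍ = M(2, ℂ) and ℍ ⊗ ℍ = M(4,
ℝ), two such steps return to the same field with matrices 16 times larger. The cases n = 0, 1, 2, 3
start the induction, and one further step gives the remaining four residues.

Tensor products appear only through commuting generating images: injectivity is never checked along
the way, since the final dimension count supplies it. -/

/-- The star algebra `A` is generated by `n` anticommuting skew-adjoint square roots of `-1`. -/
def CliffordGenerated (n : ℕ) (A : Type) [Ring A] [StarRing A] [Algebra ℝ A] : Prop :=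
  ∃ e : Fin n → A, (∀ i, e i * e i = -1) ∧ (∀ i j, i ≠ j → e i * e j = -(e j * e i)) ∧
    (∀ i, star (e i) = -e i) ∧ ∀ S : Subalgebra ℝ A, (∀ i, e i ∈ S) → S = ⊤

/-- The star algebra `B` is generated by commuting images of `A` and of the quaternions. -/
def QuaternionExtension (A B : Type) [Ring A] [StarRing A] [Algebra ℝ A]
    [Ring B] [StarRing B] [Algebra ℝ B] : Prop :=
  ∃ (φ : A →⋆ₐ[ℝ] B) (ψ : ℍ[ℝ] →⋆ₐ[ℝ] B), (∀ a q, φ a * ψ q = ψ q * φ a) ∧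
    ∀ S : Subalgebra ℝ B, (∀ a, φ a ∈ S) → (∀ q, ψ q ∈ S) → S = ⊤

section Quaternion

/-- The quaternion with the given coordinates. -/
def quaternionMk (a b c d : ℝ) : ℍ[ℝ] := ⟨a, b, c, d⟩

variable (a b c d : ℝ)

@[simp] theorem re_quaternionMk : (quaternionMk a b c d).re = a := rfl
@[simp] theorem imI_quaternionMk : (quaternionMk a b c d).imI = b := rfl
@[simp] theorem imJ_quaternionMk : (quaternionMk a b c d).imJ = c := rfl
@[simp] theorem imK_quaternionMk : (quaternionMk a b c d).imK = d := rfl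

instance starModule_quaternion : StarModule ℝ ℍ[ℝ] :=
  ⟨fun r q => by rw [Quaternion.star_smul, star_trivial r]⟩

end Quaternion

/-! ### Universal property and dimension count. -/

section CliffordAlgebra

theorem finrank_cl (n : ℕ) : Module.finrank ℝ (Cl n) = 2 ^ n := by
  let b := (Pi.basisFun ℝ (Fin n)).ExteriorAlgebra
  rw [(CliffordAlgebra.equivExterior (-euclideanForm n)).finrank_eq,
    Module.finrank_eq_card_basis b]
  simp

instance finite_cl (n : ℕ) : Module.Finite ℝ (Cl n) :=
  have := Module.Finite.of_basis (Pi.basisFun ℝ (Fin n)).ExteriorAlgebra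
  Module.Finite.equiv (CliffordAlgebra.equivExterior (-euclideanForm n)).symm

variable {n : ℕ} {A : Type} [Ring A] [Algebra ℝ A]

/-- Adding the double sum to its transpose cancels the off-diagonal terms and doubles the diagonal.
-/
theorem sum_smul_mul_self_eq {e : Fin n → A} (hsq : ∀ i, e i * e i = -1)
    (hanti : ∀ i j, i ≠ j → e i * e j = -(e j * e i)) (v : Fin n → ℝ) :
    (∑ i, v i • e i) * (∑ i, v i • e i) = algebraMap ℝ A ((-euclideanForm n) v) := by
  set s := (∑ i, v i • e i) * (∑ i, v i • e i) with hs
  have h1 : s = ∑ i, ∑ j, (v i * v j) • (e i * e j) := by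
    simp only [hs, Finset.sum_mul_sum, smul_mul_smul_comm]
  have h2 : s = ∑ i, ∑ j, (v i * v j) • (e j * e i) := by
    rw [h1, Finset.sum_comm]
    simp only [mul_comm]
  have h3 : (2 : ℝ) • s = (2 : ℝ) • algebraMap ℝ A ((-euclideanForm n) v) := by
    have key : ∀ i j, (v i * v j) • (e i * e j) + (v i * v j) • (e j * e i)
        = if i = j then (2 : ℝ) • (-(v i * v i)) • (1 : A) else 0 := by
      intro i j
      split_ifs with h
      · subst h
        rw [hsq, ← two_smul ℝ]
        simp
      · rw [hanti i j h]
        simp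
    rw [two_smul]
    nth_rewrite 1 [h1]
    rw [h2, ← Finset.sum_add_distrib]
    simp only [← Finset.sum_add_distrib, key, Finset.sum_ite_eq, Finset.mem_univ, if_true]
    rw [← Finset.smul_sum, ← Finset.sum_smul, Algebra.algebraMap_eq_smul_one]
    simp [euclideanForm]
  exact smul_right_injective A (two_ne_zero' ℝ) h3

theorem CliffordGenerated.exists_algEquiv [StarRing A] [StarModule ℝ A] [Module.Finite ℝ A]
    (h : CliffordGenerated n A) (hdim : Module.finrank ℝ A = 2 ^ n) :
    ∃ ρ : Cl n ≃ₐ[ℝ] A, ∀ x, ρ (clConj x) = star (ρ x) := by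
  obtain ⟨e, hsq, hanti, hskew, hgen⟩ := h
  let f : (Fin n → ℝ) →ₗ[ℝ] A := Fintype.linearCombination ℝ e
  have hf : ∀ v, f v = ∑ i, v i • e i := fun v => Fintype.linearCombination_apply ℝ e v
  let g : Cl n →ₐ[ℝ] A := CliffordAlgebra.lift _ ⟨f, fun v => by
    rw [hf]; exact sum_smul_mul_self_eq hsq hanti v⟩
  have hg : ∀ v, g (CliffordAlgebra.ι _ v) = ∑ i, v i • e i := fun v => by
    rw [← hf]; exact CliffordAlgebra.lift_ι_apply _ _ v
  have hsurj : Function.Surjective g := by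
    rw [← AlgHom.range_eq_top]
    refine hgen _ fun i => ⟨CliffordAlgebra.ι _ (Pi.single i 1), ?_⟩
    change g _ = _
    rw [hg]
    simp [Pi.single_apply]
  have hinj : Function.Injective g :=
    (LinearMap.injective_iff_surjective_of_finrank_eq_finrank (f := g.toLinearMap)
      (by rw [finrank_cl, hdim])).2 hsurj
  refine ⟨AlgEquiv.ofBijective g ⟨hinj, hsurj⟩, fun x => ?_⟩
  change g (clConj x) = star (g x)
  rw [show clConj x = star x from (CliffordAlgebra.star_def' x).symm]
  induction x using CliffordAlgebra.induction with
  | algebraMap r => simp [← algebraMap_star_comm]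
  | ι v => simp [hg, star_sum, hskew]
  | mul a b ha hb => simp [ha, hb]
  | add a b ha hb => simp [ha, hb]

end CliffordAlgebra

/-! ### Generation of matrix and product algebras. -/

section Generation

theorem Matrix.subalgebra_eq_top {m B : Type*} [Fintype m] [DecidableEq m] [Ring B] [Algebra ℝ B]
    (S : Subalgebra ℝ (Matrix m m B)) (h1 : ∀ i j, Matrix.single i j 1 ∈ S)
    (h2 : ∀ b, Matrix.scalar m b ∈ S) : S = ⊤ := by
  refine top_unique fun M _ => ?_
  rw [Matrix.matrix_eq_sum_single M]
  refine sum_mem fun i _ => sum_mem fun j _ => ?_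
  have : Matrix.single i j (M i j) = Matrix.scalar m (M i j) * Matrix.single i j 1 := by
    ext; simp [Matrix.single]
  rw [this]
  exact mul_mem (h2 _) (h1 _ _)

/-- The idempotent (1, 0) allows elements with prescribed projections to be glued. -/
theorem Subalgebra.prod_eq_top {A B : Type*} [Ring A] [Ring B] [Algebra ℝ A] [Algebra ℝ B]
    (S : Subalgebra ℝ (A × B)) (h : ((1, 0) : A × B) ∈ S)
    (h1 : S.map (AlgHom.fst ℝ A B) = ⊤) (h2 : S.map (AlgHom.snd ℝ A B) = ⊤) : S = ⊤ := by
  refine top_unique fun x _ => ?_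
  obtain ⟨y, hy, hyx⟩ : x.1 ∈ S.map (AlgHom.fst ℝ A B) := h1 ▸ Algebra.mem_top
  obtain ⟨z, hz, hzx⟩ : x.2 ∈ S.map (AlgHom.snd ℝ A B) := h2 ▸ Algebra.mem_top
  have : x = (1, 0) * y + (1 - (1, 0)) * z := by
    ext
    · simpa using hyx.symm
    · simpa using hzx.symm
  rw [this]
  exact add_mem (mul_mem h hy) (mul_mem (sub_mem (one_mem S) h) hz)

variable {n : ℕ} {A B A' B' : Type} [Ring A] [StarRing A] [Algebra ℝ A]
  [Ring B] [StarRing B] [Algebra ℝ B] [Ring A'] [StarRing A'] [Algebra ℝ A']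
  [Ring B'] [StarRing B'] [Algebra ℝ B']

theorem CliffordGenerated.of_surjective (h : CliffordGenerated n A) (f : A →⋆ₐ[ℝ] B)
    (hf : Function.Surjective f) : CliffordGenerated n B := by
  obtain ⟨e, hsq, hanti, hskew, hgen⟩ := h
  refine ⟨fun i => f (e i), fun i => ?_, fun i j hij => ?_, fun i => ?_, fun S hS => ?_⟩
  · rw [← map_mul, hsq, map_neg, map_one]
  · rw [← map_mul, hanti i j hij, map_neg, map_mul]
  · rw [← map_star, hskew, map_neg]
  · have := hgen (S.comap f.toAlgHom) hS
    refine top_unique fun b _ => ?_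
    obtain ⟨a, rfl⟩ := hf b
    exact (this ▸ Algebra.mem_top : a ∈ S.comap f.toAlgHom)

/-- Scalar matrices, as a star algebra homomorphism. -/
def scalarStarAlgHom (m : Type) (B : Type) [Fintype m] [DecidableEq m] [Ring B] [StarRing B]
    [Algebra ℝ B] : B →⋆ₐ[ℝ] Matrix m m B where
  __ := Matrix.scalar m
  commutes' r := by ext i j; simp [Matrix.algebraMap_matrix_apply, Matrix.diagonal_apply]
  map_star' b := by
    change Matrix.scalar m (star b) = (Matrix.scalar m b)ᴴ
    simp [Matrix.diagonal_conjTranspose, Pi.star_def]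

theorem scalarStarAlgHom_apply {m : Type} [Fintype m] [DecidableEq m] (b : B) :
    scalarStarAlgHom m B b = Matrix.scalar m b := rfl

/-- Entrywise application of a star algebra homomorphism to matrices. -/
def mapMatrixStarAlgHom (m : Type) [Fintype m] [DecidableEq m] (φ : A →⋆ₐ[ℝ] B) :
    Matrix m m A →⋆ₐ[ℝ] Matrix m m B where
  __ := φ.toAlgHom.mapMatrix
  map_star' M := by
    ext i j
    exact map_star φ (M j i)

theorem mapMatrixStarAlgHom_apply {m : Type} [Fintype m] [DecidableEq m] (φ : A →⋆ₐ[ℝ] B)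
    (M : Matrix m m A) (i j : m) : mapMatrixStarAlgHom m φ M i j = φ (M i j) := rfl

theorem QuaternionExtension.matrix (h : QuaternionExtension A B) (m : Type) [Fintype m]
    [DecidableEq m] : QuaternionExtension (Matrix m m A) (Matrix m m B) := by
  obtain ⟨φ, ψ, hcomm, hgen⟩ := h
  refine ⟨mapMatrixStarAlgHom m φ, (scalarStarAlgHom m B).comp ψ, fun M q => ?_, fun S h1 h2 => ?_⟩
  · ext i j
    simp [scalarStarAlgHom_apply, mapMatrixStarAlgHom_apply, hcomm]
  · refine Matrix.subalgebra_eq_top S (fun i j => ?_) ?_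
    · convert h1 (Matrix.single i j 1)
      ext a b
      rw [mapMatrixStarAlgHom_apply]
      simp [Matrix.single, apply_ite φ]
    · have := hgen (S.comap (scalarStarAlgHom m B).toAlgHom) (fun a => ?_) h2
      · intro b
        exact (this ▸ Algebra.mem_top : b ∈ S.comap (scalarStarAlgHom m B).toAlgHom)
      · change scalarStarAlgHom m B (φ a) ∈ S
        convert h1 (Matrix.scalar m a)
        ext i j
        simp [scalarStarAlgHom_apply, mapMatrixStarAlgHom_apply, Matrix.diagonal_apply,
          apply_ite φ]

theorem QuaternionExtension.prod (h : QuaternionExtension A B) (h' : QuaternionExtension A' B') :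
    QuaternionExtension (A × A') (B × B') := by
  obtain ⟨φ, ψ, hcomm, hgen⟩ := h
  obtain ⟨φ', ψ', hcomm', hgen'⟩ := h'
  refine ⟨(φ.comp (StarAlgHom.fst ℝ A A')).prod (φ'.comp (StarAlgHom.snd ℝ A A')), ψ.prod ψ',
    fun a q => Prod.ext (hcomm _ _) (hcomm' _ _), fun S h1 h2 => Subalgebra.prod_eq_top S ?_ ?_ ?_⟩
  · convert h1 (1, 0)
    · exact (map_one φ).symm
    · exact (map_zero φ').symm
  · exact hgen _ (fun a => ⟨_, h1 (a, 0), rfl⟩) (fun q => ⟨_, h2 q, rfl⟩)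
  · exact hgen' _ (fun a => ⟨_, h1 (0, a), rfl⟩) (fun q => ⟨_, h2 q, rfl⟩)

end Generation

/-! ### Passing from n to n + 4 generators. -/

section Step

variable {n : ℕ} {A B : Type} [Ring A] [StarRing A] [Algebra ℝ A] [Ring B] [Algebra ℝ B]

theorem CliffordGenerated.of_sum {m : ℕ} (f : Fin n → A) (g : Fin m → A)
    (hf : ∀ i, f i * f i = -1) (hff : ∀ i j, i ≠ j → f i * f j = -(f j * f i))
    (hg : ∀ i, g i * g i = -1) (hgg : ∀ i j, i ≠ j → g i * g j = -(g j * g i))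
    (hfg : ∀ i j, f i * g j = -(g j * f i))
    (hsf : ∀ i, star (f i) = -f i) (hsg : ∀ i, star (g i) = -g i)
    (hgen : ∀ S : Subalgebra ℝ A, (∀ i, f i ∈ S) → (∀ i, g i ∈ S) → S = ⊤) :
    CliffordGenerated (n + m) A := by
  refine ⟨Fin.append f g, fun i => ?_, fun i j hij => ?_, fun i => ?_, fun S hS => ?_⟩
  · refine Fin.addCases (fun i => ?_) (fun i => ?_) i <;> simp [hf, hg]
  · induction i using Fin.addCases with
    | left i =>
      induction j using Fin.addCases with
      | left j => simpa using hff i j (by rintro rfl; exact hij rfl)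
      | right j => simpa using hfg i j
    | right i =>
      induction j using Fin.addCases with
      | left j => simp [hfg]
      | right j => simpa using hgg i j (by rintro rfl; exact hij rfl)
  · refine Fin.addCases (fun i => ?_) (fun i => ?_) i <;> simp [hsf, hsg]
  · exact hgen S (fun i => by simpa using hS (Fin.castAdd m i))
      (fun i => by simpa using hS (Fin.natAdd n i))

/-- (1 + D)/2 and its complement are the diagonal matrix units; multiplying them by J gives the
others up to sign. -/
theorem Matrix.single_mem_of_diagonal_mem {S : Subalgebra ℝ (Matrix (Fin 2) (Fin 2) B)}
    (hD : !![(1 : B), 0; 0, -1] ∈ S) (hJ : !![0, -1; (1 : B), 0] ∈ S) (i j : Fin 2) :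
    Matrix.single i j 1 ∈ S := by
  have half : (2⁻¹ : ℝ) • (1 : B) + (2⁻¹ : ℝ) • (1 : B) = 1 := by
    rw [← add_smul]; norm_num
  have h0 : Matrix.single 0 0 1 ∈ S := by
    convert S.smul_mem (add_mem (one_mem S) hD) (2⁻¹ : ℝ)
    ext a b
    fin_cases a <;> fin_cases b <;> simp [Matrix.single, half]
  have h1 : Matrix.single 1 1 1 ∈ S := by
    convert sub_mem (one_mem S) h0
    ext a b
    fin_cases a <;> fin_cases b <;> simp [Matrix.single]
  fin_cases i <;> fin_cases j
  · exact h0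
  · convert neg_mem (mul_mem h0 hJ)
    ext a b
    fin_cases a <;> fin_cases b <;> simp [Matrix.single, Matrix.mul_apply]
  · convert mul_mem h1 hJ
    ext a b
    fin_cases a <;> fin_cases b <;> simp [Matrix.single, Matrix.mul_apply]
  · exact h1

theorem CliffordGenerated.quaternionExtension [StarRing B] (h : CliffordGenerated n A)
    (hB : QuaternionExtension A B) : CliffordGenerated (n + 4) (Matrix (Fin 2) (Fin 2) B) := by
  obtain ⟨e, hsq, hanti, hskew, hgen⟩ := h
  obtain ⟨φ, ψ, hcomm, hgenB⟩ := hB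
  obtain ⟨x, hx⟩ : ∃ x, x = ψ (quaternionMk 0 1 0 0) := ⟨_, rfl⟩
  obtain ⟨y, hy⟩ : ∃ y, y = ψ (quaternionMk 0 0 1 0) := ⟨_, rfl⟩
  obtain ⟨z, hz⟩ : ∃ z, z = ψ (quaternionMk 0 0 0 1) := ⟨_, rfl⟩
  have hxx : x * x = -1 := by
    rw [hx, ← map_mul, ← map_one ψ, ← map_neg]; congr 1; ext <;> simp
  have hyy : y * y = -1 := by
    rw [hy, ← map_mul, ← map_one ψ, ← map_neg]; congr 1; ext <;> simp
  have hzz : z * z = -1 := by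
    rw [hz, ← map_mul, ← map_one ψ, ← map_neg]; congr 1; ext <;> simp
  have hxy : x * y = z := by
    rw [hx, hy, hz, ← map_mul]; congr 1; ext <;> simp
  have hyx : y * x = -z := by
    rw [hx, hy, hz, ← map_mul, ← map_neg]; congr 1; ext <;> simp
  have hyz : y * z = x := by
    rw [hx, hy, hz, ← map_mul]; congr 1; ext <;> simp
  have hzy : z * y = -x := by
    rw [hx, hy, hz, ← map_mul, ← map_neg]; congr 1; ext <;> simp
  have hzx : z * x = y := by
    rw [hx, hy, hz, ← map_mul]; congr 1; ext <;> simp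
  have hxz : x * z = -y := by
    rw [hx, hy, hz, ← map_mul, ← map_neg]; congr 1; ext <;> simp
  have hsx : star x = -x := by
    rw [hx, ← map_star, ← map_neg]; congr 1; ext <;> simp
  have hsy : star y = -y := by
    rw [hy, ← map_star, ← map_neg]; congr 1; ext <;> simp
  have hsz : star z = -z := by
    rw [hz, ← map_star, ← map_neg]; congr 1; ext <;> simp
  have hφx : ∀ a, φ a * x = x * φ a := fun a => by rw [hx, hcomm]
  have hφy : ∀ a, φ a * y = y * φ a := fun a => by rw [hy, hcomm]
  have hφz : ∀ a, φ a * z = z * φ a := fun a => by rw [hz, hcomm]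
  -- The old generators are twisted by the swap matrix, which anticommutes with both diag(1, -1) and
  -- J; this turns commutation with x, y, z into anticommutation.
  refine CliffordGenerated.of_sum (fun i => !![0, φ (e i); φ (e i), 0])
    ![!![x, 0; 0, -x], !![y, 0; 0, -y], !![z, 0; 0, -z], !![0, -1; 1, 0]]
    (fun i => ?_) (fun i j hij => ?_) (fun i => ?_) (fun i j hij => ?_) (fun i j => ?_)
    (fun i => ?_) (fun i => ?_) (fun S h1 h2 => ?_)
  · simp [← map_mul, hsq, Matrix.one_fin_two]
  · simp [← map_mul, hanti i j hij]
  · fin_cases i <;> simp [hxx, hyy, hzz, Matrix.one_fin_two]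
  · fin_cases i <;> fin_cases j <;> first | exact absurd rfl hij | simp [hxy, hyx, hyz, hzy, hzx, hxz]
  · fin_cases j <;> simp [hφx, hφy, hφz]
  · ext a b
    fin_cases a <;> fin_cases b <;> simp [← map_star, hskew]
  · fin_cases i <;> ext a b <;> fin_cases a <;> fin_cases b <;> simp [hsx, hsy, hsz]
  · have hX : !![x, 0; 0, -x] ∈ S := h2 0
    have hY : !![y, 0; 0, -y] ∈ S := h2 1
    have hZ : !![z, 0; 0, -z] ∈ S := h2 2
    have hJ : !![0, -1; 1, 0] ∈ S := h2 3
    -- Since xyz = -1, the product XYZ is diag(-1, 1).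
    have hD : !![(1 : B), 0; 0, -1] ∈ S := by
      convert neg_mem (mul_mem (mul_mem hX hY) hZ) using 1
      simp [hxy, hzz]
    refine Matrix.subalgebra_eq_top S (Matrix.single_mem_of_diagonal_mem hD hJ) ?_
    let T := S.comap (scalarStarAlgHom (Fin 2) B).toAlgHom
    have memT : ∀ b, b ∈ T ↔ !![b, 0; 0, b] ∈ S := fun b => by
      have : scalarStarAlgHom (Fin 2) B b = !![b, 0; 0, b] := by
        ext i j; fin_cases i <;> fin_cases j <;> simp [scalarStarAlgHom_apply]
      rw [← this]; rfl
    have hxT : x ∈ T := by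
      rw [memT]; convert mul_mem hX hD using 1; simp
    have hyT : y ∈ T := by
      rw [memT]; convert mul_mem hY hD using 1; simp
    have hzT : z ∈ T := by
      rw [memT]; convert mul_mem hZ hD using 1; simp
    have heT : ∀ i, φ (e i) ∈ T := fun i => by
      rw [memT]; convert neg_mem (mul_mem (mul_mem (h1 i) hD) hJ) using 1; simp
    have hTtop : T = ⊤ := by
      refine hgenB T (fun a => ?_) fun q => ?_
      · have := hgen (T.comap φ.toAlgHom) heT
        exact (this ▸ Algebra.mem_top : a ∈ T.comap φ.toAlgHom)
      · have : q = q.re • 1 + q.imI • (quaternionMk 0 1 0 0) + q.imJ • (quaternionMk 0 0 1 0)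
            + q.imK • (quaternionMk 0 0 0 1) := by ext <;> simp
        rw [this]
        simp only [map_add, map_smul, map_one, ← hx, ← hy, ← hz]
        exact add_mem (add_mem (add_mem (T.smul_mem (one_mem T) _) (T.smul_mem hxT _))
          (T.smul_mem hyT _)) (T.smul_mem hzT _)
    exact fun b => (hTtop ▸ Algebra.mem_top : b ∈ T)

end Step

/-! ### Tensoring ℝ, ℂ and ℍ with the quaternions. -/

section QuaternionTensor

theorem quaternionExtension_real : QuaternionExtension ℝ (Matrix (Fin 1) (Fin 1) ℍ[ℝ]) := by
  refine ⟨StarAlgHom.ofId ℝ _, scalarStarAlgHom (Fin 1) ℍ[ℝ], fun a q => ?_, fun S _ h2 => ?_⟩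
  · exact Algebra.commutes _ _
  · refine Matrix.subalgebra_eq_top S (fun i j => ?_) h2
    convert one_mem S
    ext a b : 1
    obtain rfl := Subsingleton.elim a i
    obtain rfl := Subsingleton.elim b j
    obtain rfl := Subsingleton.elim a b
    simp

/-- The standard representation of the quaternions on `ℂ²`. -/
noncomputable def quaternionToComplexMatrix : ℍ[ℝ] →⋆ₐ[ℝ] Matrix (Fin 2) (Fin 2) ℂ where
  toFun q := !![⟨q.re, q.imI⟩, ⟨q.imJ, q.imK⟩; ⟨-q.imJ, q.imK⟩, ⟨q.re, -q.imI⟩]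
  map_one' := by
    ext i j; fin_cases i <;> fin_cases j <;> simp [Complex.ext_iff]
  map_mul' p q := by
    ext i j
    fin_cases i <;> fin_cases j <;> simp [Complex.ext_iff] <;> constructor <;> ring
  map_zero' := by
    ext i j; fin_cases i <;> fin_cases j <;> simp [Complex.ext_iff]
  map_add' p q := by
    ext i j
    fin_cases i <;> fin_cases j <;> simp [Complex.ext_iff] <;> try ring
  commutes' r := by
    ext i j
    fin_cases i <;> fin_cases j <;>
      simp [Complex.ext_iff, Matrix.algebraMap_matrix_apply]
  map_star' q := by
    ext i j; fin_cases i <;> fin_cases j <;> simp [Complex.ext_iff]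

theorem quaternionToComplexMatrix_apply (q : ℍ[ℝ]) : quaternionToComplexMatrix q =
    !![⟨q.re, q.imI⟩, ⟨q.imJ, q.imK⟩; ⟨-q.imJ, q.imK⟩, ⟨q.re, -q.imI⟩] := rfl

theorem quaternionExtension_complex : QuaternionExtension ℂ (Matrix (Fin 2) (Fin 2) ℂ) := by
  refine ⟨scalarStarAlgHom (Fin 2) ℂ, quaternionToComplexMatrix, fun a q => ?_, fun S h1 h2 => ?_⟩
  · rw [scalarStarAlgHom_apply]
    exact Matrix.scalar_comm a (fun _ => mul_comm _ _) _
  · refine Matrix.subalgebra_eq_top S (Matrix.single_mem_of_diagonal_mem ?_ ?_) h1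
    -- The quaternion i acts as diag(I, -I), so the scalar -I turns it into diag(1, -1).
    · convert mul_mem (h1 (-Complex.I)) (h2 (quaternionMk 0 1 0 0))
      ext i j
      fin_cases i <;> fin_cases j <;>
        simp [scalarStarAlgHom_apply, quaternionToComplexMatrix_apply, Complex.ext_iff]
    · convert h2 (quaternionMk 0 0 (-1) 0)
      ext i j
      fin_cases i <;> fin_cases j <;> simp [quaternionToComplexMatrix_apply, Complex.ext_iff]

/-- Left multiplication of the quaternions on themselves. -/
noncomputable def quaternionLeftMatrix : ℍ[ℝ] →⋆ₐ[ℝ] Matrix (Fin 4) (Fin 4) ℝ where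
  toFun q := !![q.re, -q.imI, -q.imJ, -q.imK; q.imI, q.re, -q.imK, q.imJ;
    q.imJ, q.imK, q.re, -q.imI; q.imK, -q.imJ, q.imI, q.re]
  map_one' := by
    ext i j; fin_cases i <;> fin_cases j <;> simp
  map_mul' p q := by
    ext i j
    fin_cases i <;> fin_cases j <;> simp [Matrix.mul_apply, Fin.sum_univ_four] <;> ring
  map_zero' := by
    ext i j; fin_cases i <;> fin_cases j <;> simp
  map_add' p q := by
    ext i j; fin_cases i <;> fin_cases j <;> simp <;> ring
  commutes' r := by
    ext i j
    fin_cases i <;> fin_cases j <;> simp [Matrix.algebraMap_matrix_apply]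
  map_star' q := by
    ext i j; fin_cases i <;> fin_cases j <;> simp

theorem quaternionLeftMatrix_apply (q : ℍ[ℝ]) : quaternionLeftMatrix q =
    !![q.re, -q.imI, -q.imJ, -q.imK; q.imI, q.re, -q.imK, q.imJ;
      q.imJ, q.imK, q.re, -q.imI; q.imK, -q.imJ, q.imI, q.re] := rfl

/-- Right multiplication of the quaternions on themselves by the conjugate. -/
noncomputable def quaternionRightMatrix : ℍ[ℝ] →⋆ₐ[ℝ] Matrix (Fin 4) (Fin 4) ℝ where
  toFun q := !![q.re, q.imI, q.imJ, q.imK; -q.imI, q.re, -q.imK, q.imJ;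
    -q.imJ, q.imK, q.re, -q.imI; -q.imK, -q.imJ, q.imI, q.re]
  map_one' := by
    ext i j; fin_cases i <;> fin_cases j <;> simp
  map_mul' p q := by
    ext i j
    fin_cases i <;> fin_cases j <;> simp [Matrix.mul_apply, Fin.sum_univ_four] <;> ring
  map_zero' := by
    ext i j; fin_cases i <;> fin_cases j <;> simp
  map_add' p q := by
    ext i j; fin_cases i <;> fin_cases j <;> simp <;> ring
  commutes' r := by
    ext i j
    fin_cases i <;> fin_cases j <;> simp [Matrix.algebraMap_matrix_apply]
  map_star' q := by
    ext i j; fin_cases i <;> fin_cases j <;> simp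

theorem quaternionRightMatrix_apply (q : ℍ[ℝ]) : quaternionRightMatrix q =
    !![q.re, q.imI, q.imJ, q.imK; -q.imI, q.re, -q.imK, q.imJ;
      -q.imJ, q.imK, q.re, -q.imI; -q.imK, -q.imJ, q.imI, q.re] := rfl

theorem quaternionExtension_quaternion :
    QuaternionExtension ℍ[ℝ] (Matrix (Fin 4) (Fin 4) ℝ) := by
  refine ⟨quaternionLeftMatrix, quaternionRightMatrix, fun p q => ?_, fun S h1 h2 => ?_⟩
  · rw [quaternionLeftMatrix_apply, quaternionRightMatrix_apply]
    ext i j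
    fin_cases i <;> fin_cases j <;> simp [Matrix.mul_apply, Fin.sum_univ_four] <;> ring
  · let b : Fin 4 → ℍ[ℝ] := ![quaternionMk 1 0 0 0, quaternionMk 0 1 0 0, quaternionMk 0 0 1 0, quaternionMk 0 0 0 1]
    -- This is the conjugation x ↦ b x b̄ by a basis unit, diagonal with signs; averaging over the
    -- four units projects onto the real line.
    have hprod : ∀ i, quaternionLeftMatrix (b i) * quaternionRightMatrix (b i) =
        Matrix.diagonal (fun k => if i = 0 ∨ k = 0 ∨ i = k then 1 else -1) := by
      intro i
      fin_cases i <;> ext k l <;> fin_cases k <;> fin_cases l <;>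
        simp [b, quaternionLeftMatrix_apply, quaternionRightMatrix_apply, Matrix.mul_apply,
          Fin.sum_univ_four]
    have h0 : Matrix.single 0 0 1 ∈ S := by
      convert S.smul_mem (sum_mem fun i (_ : i ∈ Finset.univ) =>
        mul_mem (h1 (b i)) (h2 (b i))) (4⁻¹ : ℝ)
      simp only [hprod, Fin.sum_univ_four, Matrix.diagonal_add, ← Matrix.diagonal_smul,
        ← Matrix.diagonal_single]
      congr 1
      ext k
      simp only [Pi.single_apply, Pi.smul_apply, smul_eq_mul, Fin.ext_iff]
      fin_cases k <;> norm_num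
    have hleft : ∀ i k, quaternionLeftMatrix (b i) k 0 = if i = k then 1 else 0 := fun i k => by
      fin_cases i <;> fin_cases k <;> simp [b, quaternionLeftMatrix_apply]
    have hright : ∀ j l, quaternionLeftMatrix (star (b j)) 0 l = if j = l then 1 else 0 :=
      fun j l => by fin_cases j <;> fin_cases l <;> simp [b, quaternionLeftMatrix_apply]
    have hmul : ∀ (L R : Matrix (Fin 4) (Fin 4) ℝ) (k l : Fin 4),
        (L * Matrix.single 0 0 (1 : ℝ) * R : Matrix (Fin 4) (Fin 4) ℝ) k l = L k 0 * R 0 l := fun L R k l => by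
      simp [Matrix.mul_apply, Matrix.single_apply, ite_and]
    -- Left multiplication by b i sends 1 to b i, and the one by star (b j) is a transpose, so
    -- sandwiching the projection gives the (i, j) matrix unit.
    refine Matrix.subalgebra_eq_top S (fun i j => ?_) fun r => S.algebraMap_mem r
    convert mul_mem (mul_mem (h1 (b i)) h0) (h1 (star (b j)))
    ext k l
    rw [hmul, hleft, hright, Matrix.single_apply]
    by_cases hik : i = k <;> by_cases hjl : j = l <;> simp [hik, hjl]

end QuaternionTensor

/-! ### Eightfold periodicity. -/

section Periodicity

variable {n : ℕ} {A F G : Type} [Ring A] [StarRing A] [Algebra ℝ A]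
  [Ring F] [StarRing F] [Algebra ℝ F] [Ring G] [StarRing G] [Algebra ℝ G]

/-- A matrix of matrices as a block matrix. -/
def compStarAlgHom (I J : Type) [Fintype I] [DecidableEq I] [Fintype J] [DecidableEq J]
    (B : Type) [Ring B] [StarRing B] [Algebra ℝ B] :
    Matrix I I (Matrix J J B) →⋆ₐ[ℝ] Matrix (I × J) (I × J) B where
  __ := (Matrix.compAlgEquiv I J B ℝ : _ →ₐ[ℝ] _)
  map_star' _ := rfl

/-- Relabelling the indices of matrices. -/
def reindexStarAlgHom {I J : Type} [Fintype I] [DecidableEq I] [Fintype J] [DecidableEq J]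
    (e : I ≃ J) (B : Type) [Ring B] [StarRing B] [Algebra ℝ B] :
    Matrix I I B →⋆ₐ[ℝ] Matrix J J B where
  __ := (Matrix.reindexAlgEquiv ℝ B e : _ →ₐ[ℝ] _)
  map_star' _ := rfl

theorem exists_flatten_surjective (B : Type) [Ring B] [StarRing B] [Algebra ℝ B] {p d q : ℕ}
    (hq : q = 2 * (p * d)) :
    ∃ g : Mat 2 (Mat p (Mat d B)) →⋆ₐ[ℝ] Mat q B, Function.Surjective g := by
  let e : (Fin 2 × Fin p) × Fin d ≃ Fin q := Fintype.equivOfCardEq (by simp [hq, mul_assoc])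
  refine ⟨(reindexStarAlgHom e B).comp ((compStarAlgHom _ (Fin d) B).comp
    (compStarAlgHom (Fin 2) (Fin p) (Mat d B))), ?_⟩
  have h1 := (Matrix.reindexAlgEquiv ℝ B e).surjective
  have h2 := (Matrix.compAlgEquiv (Fin 2 × Fin p) (Fin d) B ℝ).surjective
  have h3 := (Matrix.compAlgEquiv (Fin 2) (Fin p) (Mat d B) ℝ).surjective
  exact h1.comp (h2.comp h3)

theorem CliffordGenerated.matrix_add_four {p d q : ℕ} (h : CliffordGenerated n (Mat p F))
    (hF : QuaternionExtension F (Mat d G)) (hq : q = 2 * (p * d)) :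
    CliffordGenerated (n + 4) (Mat q G) := by
  obtain ⟨g, hg⟩ := exists_flatten_surjective G hq
  exact (h.quaternionExtension (hF.matrix (Fin p))).of_surjective g hg

theorem CliffordGenerated.matrix_prod_add_four {p d q : ℕ}
    (h : CliffordGenerated n (Mat p F × Mat p F))
    (hF : QuaternionExtension F (Mat d G)) (hq : q = 2 * (p * d)) :
    CliffordGenerated (n + 4) (Mat q G × Mat q G) := by
  obtain ⟨g, hg⟩ := exists_flatten_surjective G hq
  let P := Mat p (Mat d G)
  refine (h.quaternionExtension ((hF.matrix (Fin p)).prod (hF.matrix (Fin p)))).of_surjective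
    ((g.comp (mapMatrixStarAlgHom (Fin 2) (StarAlgHom.fst ℝ P P))).prod
      (g.comp (mapMatrixStarAlgHom (Fin 2) (StarAlgHom.snd ℝ P P)))) ?_
  rintro ⟨x, y⟩
  obtain ⟨X, rfl⟩ := hg x
  obtain ⟨Y, rfl⟩ := hg y
  exact ⟨Matrix.of fun i j => (X i j, Y i j), rfl⟩

/-- Two steps multiply the matrix size by 2d · 2d' = 16. -/
theorem CliffordGenerated.matrix_periodic {a d d' : ℕ} (h : CliffordGenerated a (Mat 1 F))
    (hF : QuaternionExtension F (Mat d G)) (hG : QuaternionExtension G (Mat d' F))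
    (hd : d * d' = 4) (k : ℕ) : CliffordGenerated (8 * k + a) (Mat (2 ^ (4 * k)) F) := by
  induction k with
  | zero => simpa using h
  | succ k ih =>
    have := (ih.matrix_add_four hF rfl).matrix_add_four hG (q := 2 ^ (4 * (k + 1))) (by
      calc 2 ^ (4 * (k + 1)) = 2 ^ (4 * k) * 4 * 4 := by ring
        _ = 2 ^ (4 * k) * (d * d') * 4 := by rw [hd]
        _ = _ := by ring)
    rwa [show 8 * (k + 1) + a = 8 * k + a + 4 + 4 by ring]

theorem CliffordGenerated.matrix_prod_periodic {a d d' : ℕ}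
    (h : CliffordGenerated a (Mat 1 F × Mat 1 F))
    (hF : QuaternionExtension F (Mat d G)) (hG : QuaternionExtension G (Mat d' F))
    (hd : d * d' = 4) (k : ℕ) :
    CliffordGenerated (8 * k + a) (Mat (2 ^ (4 * k)) F × Mat (2 ^ (4 * k)) F) := by
  induction k with
  | zero => simpa using h
  | succ k ih =>
    have := (ih.matrix_prod_add_four hF rfl).matrix_prod_add_four hG (q := 2 ^ (4 * (k + 1))) (by
      calc 2 ^ (4 * (k + 1)) = 2 ^ (4 * k) * 4 * 4 := by ring
        _ = 2 ^ (4 * k) * (d * d') * 4 := by rw [hd]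
        _ = _ := by ring)
    rwa [show 8 * (k + 1) + a = 8 * k + a + 4 + 4 by ring]

theorem scalarStarAlgHom_fin_one_surjective : Function.Surjective (scalarStarAlgHom (Fin 1) A) := by
  intro M
  refine ⟨M 0 0, ?_⟩
  ext i j : 1
  rw [Subsingleton.elim i 0, Subsingleton.elim j 0]
  simp [scalarStarAlgHom_apply]

theorem CliffordGenerated.matrix_fin_one (h : CliffordGenerated n A) :
    CliffordGenerated n (Mat 1 A) :=
  h.of_surjective (scalarStarAlgHom (Fin 1) A) scalarStarAlgHom_fin_one_surjective

theorem CliffordGenerated.matrix_prod_fin_one (h : CliffordGenerated n (F × G)) :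
    CliffordGenerated n (Mat 1 F × Mat 1 G) :=
  h.of_surjective (((scalarStarAlgHom (Fin 1) F).comp (StarAlgHom.fst ℝ F G)).prod
    ((scalarStarAlgHom (Fin 1) G).comp (StarAlgHom.snd ℝ F G))) fun x => by
      obtain ⟨a, ha⟩ := scalarStarAlgHom_fin_one_surjective x.1
      obtain ⟨b, hb⟩ := scalarStarAlgHom_fin_one_surjective x.2
      exact ⟨(a, b), Prod.ext ha hb⟩

end Periodicity

/-! ### The cases n = 0, 1, 2, 3. -/

section LowDimensions

theorem cliffordGenerated_real : CliffordGenerated 0 ℝ :=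
  ⟨Fin.elim0, fun i => i.elim0, fun i => i.elim0, fun i => i.elim0,
    fun S _ => top_unique fun r _ => S.algebraMap_mem r⟩

theorem cliffordGenerated_complex : CliffordGenerated 1 ℂ := by
  refine ⟨fun _ => Complex.I, fun _ => Complex.I_mul_I,
    fun i j hij => absurd (Subsingleton.elim i j) hij, fun _ => Complex.conj_I,
    fun S hS => top_unique fun z _ => ?_⟩
  have : z = z.re • 1 + z.im • Complex.I := by simp
  rw [this]
  exact add_mem (S.smul_mem (one_mem S) _) (S.smul_mem (hS 0) _)

theorem quaternion_subalgebra_eq_top (S : Subalgebra ℝ ℍ[ℝ]) (hi : quaternionMk 0 1 0 0 ∈ S)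
    (hj : quaternionMk 0 0 1 0 ∈ S) : S = ⊤ := by
  refine top_unique fun q _ => ?_
  have : q = q.re • 1 + q.imI • quaternionMk 0 1 0 0 + q.imJ • quaternionMk 0 0 1 0
      + q.imK • (quaternionMk 0 1 0 0 * quaternionMk 0 0 1 0) := by ext <;> simp
  rw [this]
  exact add_mem (add_mem (add_mem (S.smul_mem (one_mem S) _) (S.smul_mem hi _))
    (S.smul_mem hj _)) (S.smul_mem (mul_mem hi hj) _)

theorem cliffordGenerated_quaternion : CliffordGenerated 2 ℍ[ℝ] := by
  refine ⟨![quaternionMk 0 1 0 0, quaternionMk 0 0 1 0], fun i => ?_, fun i j hij => ?_,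
    fun i => ?_, fun S hS => quaternion_subalgebra_eq_top S (hS 0) (hS 1)⟩
  · fin_cases i <;> ext <;> simp
  · fin_cases i <;> fin_cases j <;> first | exact absurd rfl hij | (ext <;> simp)
  · fin_cases i <;> ext <;> simp

theorem cliffordGenerated_quaternion_prod : CliffordGenerated 3 (ℍ[ℝ] × ℍ[ℝ]) := by
  let b : Fin 3 → ℍ[ℝ] := ![quaternionMk 0 1 0 0, quaternionMk 0 0 1 0, quaternionMk 0 0 0 1]
  have hsq : ∀ i, b i * b i = -1 := fun i => by fin_cases i <;> ext <;> simp [b]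
  have hanti : ∀ i j, i ≠ j → b i * b j = -(b j * b i) := fun i j hij => by
    fin_cases i <;> fin_cases j <;> first | exact absurd rfl hij | (ext <;> simp [b])
  have hskew : ∀ i, star (b i) = -b i := fun i => by fin_cases i <;> ext <;> simp [b]
  refine ⟨fun i => (b i, -b i), fun i => ?_, fun i j hij => ?_, fun i => ?_, fun S hS => ?_⟩
  · simp [hsq, Prod.ext_iff]
  · simp [hanti i j hij]
  · simp [hskew, Prod.ext_iff]
  · refine Subalgebra.prod_eq_top S ?_ ?_ ?_
    -- The product of the three generators is (-1, 1): the opposite sign in the second factor is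
    -- what separates the two copies of ℍ.
    · have hprod : b 0 * b 1 * b 2 = -1 := by ext <;> simp [b]
      convert S.smul_mem (sub_mem (one_mem S) (mul_mem (mul_mem (hS 0) (hS 1)) (hS 2))) (2⁻¹ : ℝ)
      · simp only [Prod.smul_fst, Prod.fst_sub, Prod.fst_mul, hprod, Prod.fst_one]
        rw [sub_neg_eq_add, ← two_smul ℝ (1 : ℍ[ℝ]), smul_smul]
        norm_num
      · simp [hprod]
    · exact quaternion_subalgebra_eq_top _ ⟨_, hS 0, rfl⟩ ⟨_, hS 1, rfl⟩
    · refine quaternion_subalgebra_eq_top _ ⟨_, S.neg_mem (hS 0), ?_⟩ ⟨_, S.neg_mem (hS 1), ?_⟩ <;>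
        simp [b]

end LowDimensions

theorem finrank_mat (p : ℕ) (K : Type) [Ring K] [Algebra ℝ K] :
    Module.finrank ℝ (Mat p K) = p * p * Module.finrank ℝ K := by
  simp [Module.finrank_matrix]


theorem proposition9p1 (k : ℕ) :
    (∃ ρ : Cl (8 * k) ≃ₐ[ℝ] Mat (2 ^ (4 * k)) ℝ,
      ∀ x, ρ (clConj x) = (ρ x)ᴴ) ∧
    (∃ ρ : Cl (8 * k + 1) ≃ₐ[ℝ] Mat (2 ^ (4 * k)) ℂ,
      ∀ x, ρ (clConj x) = (ρ x)ᴴ) ∧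
    (∃ ρ : Cl (8 * k + 2) ≃ₐ[ℝ] Mat (2 ^ (4 * k)) ℍ[ℝ],
      ∀ x, ρ (clConj x) = (ρ x)ᴴ) ∧
    (∃ ρ : Cl (8 * k + 3) ≃ₐ[ℝ] Mat (2 ^ (4 * k)) ℍ[ℝ] × Mat (2 ^ (4 * k)) ℍ[ℝ],
      ∀ x, ρ (clConj x) = ((ρ x).1ᴴ, (ρ x).2ᴴ)) ∧
    (∃ ρ : Cl (8 * k + 4) ≃ₐ[ℝ] Mat (2 ^ (4 * k + 1)) ℍ[ℝ],
      ∀ x, ρ (clConj x) = (ρ x)ᴴ) ∧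
    (∃ ρ : Cl (8 * k + 5) ≃ₐ[ℝ] Mat (2 ^ (4 * k + 2)) ℂ,
      ∀ x, ρ (clConj x) = (ρ x)ᴴ) ∧
    (∃ ρ : Cl (8 * k + 6) ≃ₐ[ℝ] Mat (2 ^ (4 * k + 3)) ℝ,
      ∀ x, ρ (clConj x) = (ρ x)ᴴ) ∧
    (∃ ρ : Cl (8 * k + 7) ≃ₐ[ℝ] Mat (2 ^ (4 * k + 3)) ℝ × Mat (2 ^ (4 * k + 3)) ℝ,
      ∀ x, ρ (clConj x) = ((ρ x).1ᴴ, (ρ x).2ᴴ)) := by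
  have real := cliffordGenerated_real.matrix_fin_one.matrix_periodic quaternionExtension_real
    quaternionExtension_quaternion rfl k
  have complex := cliffordGenerated_complex.matrix_fin_one.matrix_periodic
    quaternionExtension_complex quaternionExtension_complex rfl k
  have quaternion := cliffordGenerated_quaternion.matrix_fin_one.matrix_periodic
    quaternionExtension_quaternion quaternionExtension_real rfl k
  have quaternionProd := cliffordGenerated_quaternion_prod.matrix_prod_fin_one.matrix_prod_periodic
    quaternionExtension_quaternion quaternionExtension_real rfl k
  refine ⟨real.exists_algEquiv ?_, complex.exists_algEquiv ?_, quaternion.exists_algEquiv ?_,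
    quaternionProd.exists_algEquiv ?_,
    (real.matrix_add_four quaternionExtension_real (by ring)).exists_algEquiv ?_,
    (complex.matrix_add_four quaternionExtension_complex (by ring)).exists_algEquiv ?_,
    (quaternion.matrix_add_four quaternionExtension_quaternion (by ring)).exists_algEquiv ?_,
    (quaternionProd.matrix_prod_add_four quaternionExtension_quaternion
      (by ring)).exists_algEquiv ?_⟩ <;>
  simp only [Module.finrank_prod, finrank_mat, Module.finrank_self, Complex.finrank_real_complex,
    Quaternion.finrank_eq_four] <;> ring
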